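/- Let $\mathbb K$ be a field of characteristic zero and let $f\in\mathbb K[[x]]$ be unitary, i.e. $f(0)=0$ and $f'(0)=1$. Let $f^{-1}$ be its compositional inverse, let $D=d/dx$ on $\mathbb K[x]$, and let $Q=f^{-1}(D)$, that is $Q=\sum_n c_nD^n$ where $f^{-1}(t)=\sum_n c_nt^n$. Let $\phi\rightsquigarrow f^{-1}(D)$ be the umbral operator of $Q$: an invertible linear operator on $\mathbb K[x]$ whose polynomials $\phi_n=\phi x^n$ satisfy $\phi_0=1$, $\phi_n(0)=0$ for $n>0$, $Q\phi_0=0$ and $Q\phi_n=n\phi_{n-1}$ for $n>0$. For a linear operator $U$ on $\mathbb K[x]$ define its coefficients $\left[{n\atop k}\right]_U$ by $Ux^n=\sum_k\left[{n\atop k}\right]_Ux^k$. Write $\binom{s}{p}=s(s-1)\cdots(s-p+1)/p!$ for $s\in\mathbb K$, $p\in\mathbb N$. There is exactly one family $(f^s)_{s\in\mathbb K}$ of power series without constant term, whose coefficients are polynomial functions of $s$, such that $f^1=f$ and $f^r\circ f^s=f^{r+s}$ for all $r,s\in\mathbb K$ (the fractional iterates of $f$); let $f_*=\left.\frac{d f^s}{ds}\right|_{s=0}$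 be the iterative logarithm of $f$, the derivative being taken coefficientwise (each coefficient has a well-defined derivative, being a polynomial in $s$). Here $f^s(x)^k$ denotes the $k$-th power, in the ring $\mathbb K[[x]]$, of the $s$-th iterate. For all $s\in\mathbb K$ and $k\in\mathbb N=\{0,1,2,\dots\}$, $$\frac{f^s(x)^k}{k!}=\sum_{n=k}^\infty\frac{x^n}{n!}\sum_{p=0}^{n-k}\binom sp\left[{n\atop k}\right]_{(\phi-1)^p}=\sum_{n=k}^\infty\frac{x^n}{n!}\sum_{p=0}^{n-k}\binom sp\binom{n-k-s}{n-k-p}\left[{n\atop k}\right]_{\phi^p},$$ and $$f_*(x)=\sum_{n=2}^\infty\frac{x^n}{n!}\sum_{p=1}^{n-1}\frac{(-1)^{p-1}}{p}\left[{n\atop 1}\right]_{(\phi-1)^p}=\sum_{n=2}^\infty\frac{x^n}{n!}\sum_{p=1}^{n-1}\frac{(-1)^{p-1}}{p}\binom{n-1}{p}\left[{n\atop 1}\right]_{\phi^p}.$$ -/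

import Mathlib

noncomputable section

namespace Umbral

variable {K : Type*} [Field K]

/-- A formal power series `f` is unitary when `f(0) = 0` and `f'(0) = 1`. -/
structure IsUnitary (f : PowerSeries K) : Prop where
  constantCoeff_eq : PowerSeries.constantCoeff f = 0
  coeff_one_eq : PowerSeries.coeff 1 f = 1

theorem IsUnitary.isUnit_coeff_one {f : PowerSeries K} (hf : IsUnitary f) :
    IsUnit (PowerSeries.coeff 1 f) := by
  rw [hf.coeff_one_eq]; exact isUnit_one

/-- The compositional inverse `f⁻¹` of a unitary power series. -/
def IsUnitary.compInv {f : PowerSeries K} (hf : IsUnitary f) : PowerSeries K :=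
  f.substInvOfIsUnit hf.isUnit_coeff_one

theorem sum_derivative_eq (h : PowerSeries K) (p : Polynomial K) {N : ℕ}
    (hN : p.natDegree + 1 ≤ N) :
    ∑ n ∈ Finset.range (p.natDegree + 1),
        PowerSeries.coeff n h • (Polynomial.derivative^[n] p) =
      ∑ n ∈ Finset.range N, PowerSeries.coeff n h • (Polynomial.derivative^[n] p) := by
  refine Finset.sum_subset (Finset.range_mono hN) fun n _ hn => ?_
  rw [Polynomial.iterate_derivative_eq_zero (by simpa using hn), smul_zero]

/-- The operator `h(D) = ∑ₙ hₙ Dⁿ` on polynomials, where `D` is the derivative; applied to a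
polynomial the sum stops at the degree. -/
def opD (h : PowerSeries K) : Module.End K (Polynomial K) where
  toFun p := ∑ n ∈ Finset.range (p.natDegree + 1),
    PowerSeries.coeff n h • (Polynomial.derivative^[n] p)
  map_add' p q := by
    have hp : p.natDegree + 1 ≤ p.natDegree + q.natDegree + 1 := by omega
    have hq : q.natDegree + 1 ≤ p.natDegree + q.natDegree + 1 := by omega
    have hpq : (p + q).natDegree + 1 ≤ p.natDegree + q.natDegree + 1 := by
      have := Polynomial.natDegree_add_le p q
      omega
    rw [sum_derivative_eq h p hp, sum_derivative_eq h q hq, sum_derivative_eq h (p + q) hpq,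
      ← Finset.sum_add_distrib]
    simp [iterate_map_add]
  map_smul' c p := by
    rw [sum_derivative_eq h (c • p) (N := p.natDegree + 1)
      (Nat.succ_le_succ (Polynomial.natDegree_smul_le c p)), RingHom.id_apply, Finset.smul_sum]
    refine Finset.sum_congr rfl fun n _ => ?_
    rw [Polynomial.iterate_derivative_smul, smul_comm]

/-- `φ ⇝ Q`: the linear operator `φ` on polynomials is an umbral operator for `Q`. It is
invertible, its sequence `φₙ = φ xⁿ` satisfies `Q φ₀ = 0` and `Q φₙ = n φₙ₋₁` for `n > 0`,
`φ₀ = 1`, and `φₙ(0) = 0` for `n > 0`. -/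
structure IsUmbral (φ Q : Module.End K (Polynomial K)) : Prop where
  isUnit : IsUnit φ
  sheffer_zero : Q (φ (Polynomial.X ^ 0)) = 0
  sheffer_succ : ∀ n : ℕ,
    Q (φ (Polynomial.X ^ (n + 1))) = ((n + 1 : ℕ) : K) • φ (Polynomial.X ^ n)
  map_one : φ (Polynomial.X ^ 0) = 1
  eval_zero : ∀ n : ℕ, 0 < n → (φ (Polynomial.X ^ n)).eval 0 = 0

/-- The coefficient `[n, k]_U` of a linear operator `U` on polynomials:
`U xⁿ = ∑ₖ [n, k]_U xᵏ`. -/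
def opCoeff (U : Module.End K (Polynomial K)) (n k : ℕ) : K :=
  (U (Polynomial.X ^ n)).coeff k

/-- `F` is the family `(f ^ s)` of fractional iterates of `f`: power series without constant
term, with `f ^ 1 = f` and `f ^ r ∘ f ^ s = f ^ (r + s)`, whose coefficients are polynomials in
the exponent `s`. -/
structure IsFractionalIteration (f : PowerSeries K) (F : K → PowerSeries K) : Prop where
  constantCoeff_eq : ∀ s, PowerSeries.constantCoeff (F s) = 0
  one : F 1 = f
  comp : ∀ r s, PowerSeries.subst (F s) (F r) = F (r + s)
  polynomial : ∀ n, ∃ P : Polynomial K, ∀ s, PowerSeries.coeff n (F s) = P.eval s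

/-- `g` is the coefficientwise derivative at `s = 0` of the family `F`, whose coefficients are
polynomials in `s`. For the family of fractional iterates of `f` this is the iterative
logarithm of `f`. -/
def IsIterativeLog (F : K → PowerSeries K) (g : PowerSeries K) : Prop :=
  ∀ n, ∃ P : Polynomial K, (∀ s, PowerSeries.coeff n (F s) = P.eval s) ∧
    PowerSeries.coeff n g = P.derivative.eval 0

end Umbral

end

/-
Pair `K⟦X⟧` with `K[X]` by `⟨g, p⟩ = (g(D) p)(0)`. Multiplication by `h` is then transpose to
`h(D)`, and the conditions on `φₙ` say precisely that `φ` is transpose to the composition operator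
`T : g ↦ g ∘ f`. Hence `φ ^ p` and `(φ - 1) ^ p` are transpose to `T ^ p` and `(T - 1) ^ p`, and
the theorem becomes a statement about `T`.

As `f` is unitary, `T - 1` raises orders, so that `T ^ s = ∑ₚ (s choose p) (T - 1) ^ p` makes sense
for an indeterminate `s`. Coefficients of `T ^ s g` are polynomials in `s`, and identities between
them need only be checked for natural numbers `s`, where `T ^ s g = g ∘ f ∘ ⋯ ∘ f`. This gives
`(T ^ s x) ^ k = T ^ s x ^ k` and the iteration law for `f ^ s = T ^ s x`. The coefficient of `xⁿ` in
`T ^ s x ^ k` has degree at most `n - k` in `s`, so it is also determined by its values at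
`0, …, n - k`; this yields the formula in the powers of `φ`.
-/

noncomputable section

namespace Umbral

open scoped Nat Polynomial PowerSeries
open PowerSeries (coeff constantCoeff)

section Composition

variable {R : Type*} [CommRing R]

/-- The composition operator `g ↦ g ∘ a` on power series, for `a` without constant term. -/
def compOp {a : R⟦X⟧} (ha : constantCoeff a = 0) : Module.End R R⟦X⟧ :=
  (PowerSeries.substAlgHom (.of_constantCoeff_zero' ha) : R⟦X⟧ →ₐ[R] R⟦X⟧).toLinearMap

variable {a : R⟦X⟧} (ha : constantCoeff a = 0)

theorem compOp_apply (g : R⟦X⟧) : compOp ha g = g.subst a :=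
  congrFun (PowerSeries.coe_substAlgHom (.of_constantCoeff_zero' ha)) g

include ha in
theorem subst_eq_mul_subst_add_C (g : R⟦X⟧) :
    g.subst a = a * (PowerSeries.mk fun n => coeff (n + 1) g).subst a +
      PowerSeries.C (constantCoeff g) := by
  have hsub : PowerSeries.HasSubst a := .of_constantCoeff_zero' ha
  conv_lhs => rw [g.eq_X_mul_shift_add_const, PowerSeries.subst_add hsub,
    PowerSeries.subst_mul hsub, PowerSeries.subst_X hsub, PowerSeries.subst_C]
  rfl

include ha in
theorem constantCoeff_subst_eq (g : R⟦X⟧) : constantCoeff (g.subst a) = constantCoeff g := by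
  rw [subst_eq_mul_subst_add_C ha, map_add, map_mul, ha, zero_mul, zero_add,
    PowerSeries.constantCoeff_C]

theorem constantCoeff_compOp_pow_X (m : ℕ) :
    constantCoeff ((compOp ha ^ m) PowerSeries.X) = 0 := by
  induction m with
  | zero => exact PowerSeries.constantCoeff_X
  | succ m ih => rw [pow_succ', Module.End.mul_apply, compOp_apply, constantCoeff_subst_eq ha, ih]

theorem compOp_pow_apply (m : ℕ) (g : R⟦X⟧) :
    (compOp ha ^ m) g = g.subst ((compOp ha ^ m) PowerSeries.X) := by
  induction m with
  | zero => exact (PowerSeries.X_subst g).symm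
  | succ m ih =>
    rw [pow_succ', Module.End.mul_apply, ih, Module.End.mul_apply, compOp_apply, compOp_apply,
      PowerSeries.subst_comp_subst_apply
        (.of_constantCoeff_zero' (constantCoeff_compOp_pow_X ha m)) (.of_constantCoeff_zero' ha)]

theorem compOp_pow_X_pow (m k : ℕ) :
    (compOp ha ^ m) (PowerSeries.X ^ k) = (compOp ha ^ m) PowerSeries.X ^ k := by
  have hsub : PowerSeries.HasSubst ((compOp ha ^ m) PowerSeries.X) :=
    .of_constantCoeff_zero' (constantCoeff_compOp_pow_X ha m)
  rw [compOp_pow_apply, PowerSeries.subst_pow hsub, PowerSeries.subst_X hsub]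

end Composition

section Order

variable {R : Type*} [CommRing R]

theorem eq_mk_ite_iff {h : R⟦X⟧} {k : ℕ} (hk : PowerSeries.X ^ k ∣ h)
    (c : ℕ → R) :
    (h = PowerSeries.mk fun n => if k ≤ n then c n else 0) ↔ ∀ n, k ≤ n → coeff n h = c n := by
  refine PowerSeries.ext_iff.trans (forall_congr' fun n => ?_)
  rw [PowerSeries.coeff_mk]
  rcases le_or_gt k n with hn | hn
  · simp only [hn, if_true, true_imp_iff]
  · simp only [hn.not_ge, if_false, false_imp_iff, PowerSeries.X_pow_dvd_iff.mp hk n hn]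

/-- `Δ` raises the order of every power series by at least one. -/
def RaisesOrder (Δ : Module.End R R⟦X⟧) : Prop :=
  ∀ ⦃k : ℕ⦄ ⦃g : R⟦X⟧⦄, PowerSeries.X ^ k ∣ g → PowerSeries.X ^ (k + 1) ∣ Δ g

theorem RaisesOrder.X_pow_dvd_pow_apply {Δ : Module.End R R⟦X⟧} (hΔ : RaisesOrder Δ) {k : ℕ}
    {g : R⟦X⟧} (hg : PowerSeries.X ^ k ∣ g) (p : ℕ) : PowerSeries.X ^ (k + p) ∣ (Δ ^ p) g := by
  induction p with
  | zero => exact hg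
  | succ p ih =>
    rw [pow_succ', Module.End.mul_apply]
    exact hΔ ih

theorem RaisesOrder.coeff_pow_apply_eq_zero {Δ : Module.End R R⟦X⟧} (hΔ : RaisesOrder Δ)
    {k n p : ℕ} {g : R⟦X⟧} (hg : PowerSeries.X ^ k ∣ g) (h : n < k + p) :
    coeff n ((Δ ^ p) g) = 0 :=
  PowerSeries.X_pow_dvd_iff.mp (hΔ.X_pow_dvd_pow_apply hg p) n h

theorem IsUnitary.raisesOrder_compOp_sub_one {K : Type*} [Field K] {f : K⟦X⟧} (hf : IsUnitary f) :
    RaisesOrder (compOp hf.constantCoeff_eq - 1) := by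
  rintro k _ ⟨h, rfl⟩
  have hsub : PowerSeries.HasSubst f := .of_constantCoeff_zero' hf.constantCoeff_eq
  obtain ⟨u, hu⟩ := PowerSeries.X_dvd_iff.mpr hf.constantCoeff_eq
  have hu₀ : constantCoeff u = 1 := by
    rw [← hf.coeff_one_eq, hu, ← zero_add 1, PowerSeries.coeff_succ_X_mul,
      PowerSeries.coeff_zero_eq_constantCoeff_apply]
  have key : (compOp hf.constantCoeff_eq - 1) (PowerSeries.X ^ k * h) =
      PowerSeries.X ^ k * (u ^ k * h.subst f - h) := by
    rw [LinearMap.sub_apply, Module.End.one_apply, compOp_apply, PowerSeries.subst_mul hsub,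
      PowerSeries.subst_pow hsub, PowerSeries.subst_X hsub, mul_sub, ← mul_assoc, ← mul_pow, ← hu]
  rw [key, pow_succ]
  refine mul_dvd_mul_left _ (PowerSeries.X_dvd_iff.mpr ?_)
  rw [map_sub, map_mul, map_pow, hu₀, one_pow, one_mul, constantCoeff_subst_eq hf.constantCoeff_eq,
    sub_self]

end Order

section PolynomialFamilies

variable {R : Type*} [CommRing R]

/-- A series over `R[X]` encodes a family of power series over `R` whose coefficients are
polynomials in a parameter; `specialize s` is its member at the parameter `s`. -/
def specialize (s : R) : R[X]⟦X⟧ →+* R⟦X⟧ := PowerSeries.map (Polynomial.evalRingHom s)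

theorem coeff_specialize (s : R) (Φ : R[X]⟦X⟧) (n : ℕ) :
    coeff n (specialize s Φ) = (coeff n Φ).eval s := rfl

theorem specialize_map_C (s : R) (g : R⟦X⟧) : specialize s (g.map Polynomial.C) = g := by
  ext n
  simp [coeff_specialize]

theorem specialize_subst (s : R) {Φ : R[X]⟦X⟧} (hΦ : constantCoeff Φ = 0) (Ψ : R[X]⟦X⟧) :
    specialize s (Ψ.subst Φ) = (specialize s Ψ).subst (specialize s Φ) :=
  PowerSeries.map_subst (.of_constantCoeff_zero' hΦ) Ψ

theorem specialize_map_compRingHom (s : R) (P : R[X]) (Φ : R[X]⟦X⟧) :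
    specialize s (Φ.map (Polynomial.compRingHom P)) = specialize (P.eval s) Φ := by
  ext n
  simp [coeff_specialize, Polynomial.eval_comp]

theorem exists_specialize_eq {F : R → R⟦X⟧}
    (hF : ∀ n, ∃ P : R[X], ∀ s, coeff n (F s) = P.eval s) :
    ∃ Φ : R[X]⟦X⟧, ∀ s, F s = specialize s Φ := by
  choose P hP using hF
  refine ⟨PowerSeries.mk P, fun s => ?_⟩
  ext n
  rw [hP, coeff_specialize, PowerSeries.coeff_mk]

variable [IsDomain R] [CharZero R]

theorem polynomial_eq_of_eval_natCast_eq {P Q : R[X]}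
    (h : ∀ m : ℕ, P.eval (m : R) = Q.eval (m : R)) : P = Q :=
  Polynomial.eq_of_infinite_eval_eq P Q <|
    (Set.infinite_range_of_injective Nat.cast_injective).mono (Set.range_subset_iff.mpr h)

theorem eq_of_specialize_natCast_eq {Φ Ψ : R[X]⟦X⟧}
    (h : ∀ m : ℕ, specialize (m : R) Φ = specialize (m : R) Ψ) : Φ = Ψ := by
  ext1 n
  exact polynomial_eq_of_eval_natCast_eq fun m => congrArg (coeff n) (h m)

theorem specialize_subst_specialize {Φ : R[X]⟦X⟧} (hΦ : constantCoeff Φ = 0)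
    (h : ∀ a b : ℕ, (specialize (a : R) Φ).subst (specialize (b : R) Φ) =
      specialize ((a : R) + b) Φ) (r s : R) :
    (specialize r Φ).subst (specialize s Φ) = specialize (r + s) Φ := by
  have h_natCast (a : ℕ) (s : R) :
      (specialize (a : R) Φ).subst (specialize s Φ) = specialize (a + s) Φ := by
    have key : ((specialize (a : R) Φ).map Polynomial.C).subst Φ =
        Φ.map (Polynomial.compRingHom (Polynomial.C (a : R) + Polynomial.X)) :=
      eq_of_specialize_natCast_eq fun b => by
        rw [specialize_subst _ hΦ, specialize_map_C, specialize_map_compRingHom, h]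
        simp
    simpa [specialize_subst _ hΦ, specialize_map_C, specialize_map_compRingHom] using
      congrArg (specialize s) key
  have hs : constantCoeff ((specialize s Φ).map Polynomial.C) = 0 := by
    rw [← PowerSeries.coeff_zero_eq_constantCoeff_apply] at hΦ ⊢
    rw [PowerSeries.coeff_map, coeff_specialize, hΦ, Polynomial.eval_zero, Polynomial.C_0]
  have key : Φ.subst ((specialize s Φ).map Polynomial.C) =
      Φ.map (Polynomial.compRingHom (Polynomial.X + Polynomial.C s)) :=
    eq_of_specialize_natCast_eq fun a => by
      rw [specialize_subst _ hs, specialize_map_C, specialize_map_compRingHom, h_natCast]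
      simp
  simpa [specialize_subst _ hs, specialize_map_C, specialize_map_compRingHom] using
    congrArg (specialize r) key

end PolynomialFamilies

section BinomialPolynomials

variable {K : Type*} [Field K]

/-- The binomial coefficient `X (X - 1) ⋯ (X - p + 1) / p!` as a polynomial in its upper entry. -/
def choosePoly (K : Type*) [Field K] (p : ℕ) : K[X] :=
  Polynomial.C (p ! : K)⁻¹ * descPochhammer K p

theorem natDegree_choosePoly_le (p : ℕ) : (choosePoly K p).natDegree ≤ p :=
  (Polynomial.natDegree_C_mul_le _ _).trans (descPochhammer_natDegree K p).le

theorem natDegree_choosePoly_comp_natCast_sub_X_le (N p : ℕ) :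
    ((choosePoly K p).comp (Polynomial.C (N : K) - Polynomial.X)).natDegree ≤ p := by
  have h_lin : (Polynomial.C (N : K) - Polynomial.X).natDegree ≤ 1 := by compute_degree
  exact Polynomial.natDegree_comp_le.trans <|
    (Nat.mul_le_mul (natDegree_choosePoly_le p) h_lin).trans (mul_one p).le

theorem choosePoly_zero : choosePoly K 0 = 1 := by
  simp [choosePoly]

variable [CharZero K]

theorem eval_choosePoly (p : ℕ) (s : K) : (choosePoly K p).eval s = Ring.choose s p := by
  rw [Ring.choose_eq_smul, choosePoly, Polynomial.eval_mul, Polynomial.eval_C, smul_eq_mul,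
    ← descPochhammer_map (Int.castRingHom K), Polynomial.eval_map,
    ← Polynomial.eval₂_smulOneHom_eq_smeval]
  congr 2
  exact RingHom.ext_int _ _

theorem eval_neg_one_descPochhammer {R : Type*} [CommRing R] (p : ℕ) :
    (descPochhammer R p).eval (-1) = (-1) ^ p * (p ! : R) := by
  have h := ascPochhammer_eval_neg_eq_descPochhammer R (-1) p
  rw [neg_neg, ascPochhammer_eval_one] at h
  rw [h, ← mul_assoc, ← mul_pow]
  simp

theorem eval_zero_derivative_choosePoly_mul {p : ℕ} (hp : p ≠ 0) (Q : K[X]) :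
    (Polynomial.derivative (choosePoly K p * Q)).eval 0 = (-1) ^ (p - 1) / p * Q.eval 0 := by
  obtain ⟨p, rfl⟩ := Nat.exists_eq_succ_of_ne_zero hp
  have hfac : (p ! : K) ≠ 0 := Nat.cast_ne_zero.mpr p.factorial_ne_zero
  have hsucc : ((p : K) + 1) ≠ 0 := Nat.cast_add_one_ne_zero p
  have h_deriv : (Polynomial.derivative (choosePoly K (p + 1) * Q)).eval 0 =
      ((p + 1)! : K)⁻¹ * (descPochhammer K p).eval (-1) * Q.eval 0 := by
    simp [choosePoly, descPochhammer_succ_left, Polynomial.derivative_mul, Polynomial.eval_comp]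
  rw [h_deriv, eval_neg_one_descPochhammer, Nat.succ_eq_add_one, Nat.add_sub_cancel,
    Nat.factorial_succ, Nat.cast_mul, Nat.cast_add_one]
  field_simp

theorem eval_zero_derivative_sum_choosePoly_mul (N : ℕ) (Q : ℕ → K[X]) :
    (Polynomial.derivative (∑ p ∈ Finset.Icc 0 N, choosePoly K p * Q p)).eval 0 =
      (Polynomial.derivative (Q 0)).eval 0 +
        ∑ p ∈ Finset.Icc 1 N, (-1) ^ (p - 1) / p * (Q p).eval 0 := by
  rw [Polynomial.derivative_sum, Polynomial.eval_finsetSum,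
    ← Finset.insert_Icc_add_one_left_eq_Icc N.zero_le, Finset.sum_insert (by simp),
    choosePoly_zero, one_mul]
  congr 1
  refine Finset.sum_congr rfl fun p hp => eval_zero_derivative_choosePoly_mul ?_ _
  exact Nat.one_le_iff_ne_zero.mp (Finset.mem_Icc.mp hp).1

theorem choose_mul_choose_sub_eq_ite {N m : ℕ} (hm : m ≤ N) (p : ℕ) :
    m.choose p * (N - m).choose (N - p) = if p = m then 1 else 0 := by
  rcases lt_trichotomy p m with h | rfl | h
  · rw [Nat.choose_eq_zero_of_lt (n := N - m) (by lia), mul_zero, if_neg h.ne]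
  · rw [Nat.choose_self, Nat.choose_self, mul_one, if_pos rfl]
  · rw [Nat.choose_eq_zero_of_lt h, zero_mul, if_neg h.ne']

theorem eq_sum_choosePoly_mul_comp {P : K[X]} {N : ℕ} (hP : P.natDegree ≤ N) :
    P = ∑ p ∈ Finset.Icc 0 N, choosePoly K p *
      (choosePoly K (N - p)).comp (Polynomial.C (N : K) - Polynomial.X) *
        Polynomial.C (P.eval (p : K)) := by
  set S : Finset K := (Finset.range (N + 1)).map Nat.castEmbedding
  have hcard : S.card = N + 1 := by rw [Finset.card_map, Finset.card_range]
  refine Polynomial.eq_of_natDegree_lt_card_of_eval_eq' _ _ S ?_ ?_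
  · intro x hx
    obtain ⟨m, hm, rfl⟩ := Finset.mem_map.mp hx
    have hmN : m ≤ N := Nat.lt_succ_iff.mp (Finset.mem_range.mp hm)
    have h_term (p : ℕ) :
        (choosePoly K p * (choosePoly K (N - p)).comp (Polynomial.C (N : K) - Polynomial.X) *
          Polynomial.C (P.eval (p : K))).eval (m : K) = if p = m then P.eval (m : K) else 0 := by
      simp only [Polynomial.eval_mul, Polynomial.eval_comp, Polynomial.eval_sub, Polynomial.eval_C,
        Polynomial.eval_X, eval_choosePoly, ← Nat.cast_sub hmN, Ring.choose_natCast,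
        ← Nat.cast_mul, choose_mul_choose_sub_eq_ite hmN]
      split_ifs with hpm <;> simp [hpm]
    rw [Nat.castEmbedding_apply, Polynomial.eval_finsetSum,
      Finset.sum_congr rfl fun p _ => h_term p, Finset.sum_ite_eq',
      if_pos (Finset.mem_Icc.mpr ⟨m.zero_le, hmN⟩)]
  · rw [hcard, Nat.lt_succ_iff]
    refine max_le hP (Polynomial.natDegree_sum_le_of_forall_le _ _ fun p hp => ?_)
    calc
      _ ≤ p + (N - p) := (Polynomial.natDegree_mul_C_le _ _).trans <|
        Polynomial.natDegree_mul_le_of_le (natDegree_choosePoly_le p)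
          (natDegree_choosePoly_comp_natCast_sub_X_le N (N - p))
      _ = N := Nat.add_sub_cancel' (Finset.mem_Icc.mp hp).2

theorem eval_eq_sum_choose_mul_choose {P : K[X]} {N : ℕ} (hP : P.natDegree ≤ N) (s : K) :
    P.eval s = ∑ p ∈ Finset.Icc 0 N,
      Ring.choose s p * Ring.choose ((N : K) - s) (N - p) * P.eval (p : K) := by
  conv_lhs => rw [eq_sum_choosePoly_mul_comp hP]
  simp [Polynomial.eval_finsetSum, Polynomial.eval_comp, eval_choosePoly, mul_assoc]

theorem eval_zero_derivative_eq_sum_choose {P : K[X]} {N : ℕ} (hP : P.natDegree ≤ N)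
    (hP₀ : P.eval 0 = 0) :
    (Polynomial.derivative P).eval 0 =
      ∑ p ∈ Finset.Icc 1 N, (-1) ^ (p - 1) / p * N.choose p * P.eval (p : K) := by
  conv_lhs =>
    rw [eq_sum_choosePoly_mul_comp hP]
    simp only [mul_assoc]
    rw [eval_zero_derivative_sum_choosePoly_mul]
  simp only [Nat.cast_zero, hP₀, Polynomial.C_0, mul_zero, Polynomial.derivative_zero,
    Polynomial.eval_zero, zero_add]
  refine Finset.sum_congr rfl fun p hp => ?_
  rw [Polynomial.eval_mul, Polynomial.eval_C, Polynomial.eval_comp, eval_choosePoly,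
    Polynomial.eval_sub, Polynomial.eval_C, Polynomial.eval_X, sub_zero, Ring.choose_natCast,
    Nat.choose_symm (Finset.mem_Icc.mp hp).2, mul_assoc]

end BinomialPolynomials

section FractionalPowers

variable {K : Type*} [Field K]

theorem pow_eq_sum_choose_smul_sub_one_pow {A : Type*} [Ring A] (a : A) (m : ℕ) :
    a ^ m = ∑ p ∈ Finset.range (m + 1), m.choose p • (a - 1) ^ p := by
  conv_lhs => rw [← sub_add_cancel a 1, (Commute.one_right (a - 1)).add_pow]
  simp only [one_pow, mul_one, nsmul_eq_mul']

/-- The family `T ^ s g = ∑ₚ (s choose p) (T - 1) ^ p g`, with the exponent `s` as the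
indeterminate of the coefficient ring. The sum over `p ≤ n` is the full one when `T - 1` raises
orders, the only case in which this notion is meant to be used. -/
def fracPow (T : Module.End K K⟦X⟧) (g : K⟦X⟧) : K[X]⟦X⟧ :=
  PowerSeries.mk fun n => ∑ p ∈ Finset.Icc 0 n,
    choosePoly K p * Polynomial.C (coeff n (((T - 1) ^ p) g))

variable {T : Module.End K K⟦X⟧} (hT : RaisesOrder (T - 1)) {k : ℕ} {g : K⟦X⟧}
include hT

theorem coeff_fracPow_of_X_pow_dvd (hg : PowerSeries.X ^ k ∣ g) {n N : ℕ} (hN : n - k ≤ N) :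
    coeff n (fracPow T g) = ∑ p ∈ Finset.Icc 0 N,
      choosePoly K p * Polynomial.C (coeff n (((T - 1) ^ p) g)) := by
  have h_zero (p : ℕ) (hp : n < k + p) :
      choosePoly K p * Polynomial.C (coeff n (((T - 1) ^ p) g)) = 0 := by
    rw [hT.coeff_pow_apply_eq_zero hg hp, Polynomial.C_0, mul_zero]
  have h_trunc {M : ℕ} (hM : n - k ≤ M) :
      ∑ p ∈ Finset.Icc 0 (n - k), choosePoly K p * Polynomial.C (coeff n (((T - 1) ^ p) g)) =
        ∑ p ∈ Finset.Icc 0 M, choosePoly K p * Polynomial.C (coeff n (((T - 1) ^ p) g)) :=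
    Finset.sum_subset (Finset.Icc_subset_Icc_right hM) fun p _ hp =>
      h_zero p (by rw [Finset.mem_Icc] at hp; lia)
  rw [fracPow, PowerSeries.coeff_mk, ← h_trunc (n.sub_le k), h_trunc hN]

theorem natDegree_coeff_fracPow_le (hg : PowerSeries.X ^ k ∣ g) (n : ℕ) :
    (coeff n (fracPow T g)).natDegree ≤ n - k := by
  rw [coeff_fracPow_of_X_pow_dvd hT hg le_rfl]
  refine Polynomial.natDegree_sum_le_of_forall_le _ _ fun p hp => ?_
  exact (Polynomial.natDegree_mul_C_le _ _).trans
    ((natDegree_choosePoly_le p).trans (Finset.mem_Icc.mp hp).2)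

variable [CharZero K]

theorem specialize_natCast_fracPow (g : K⟦X⟧) (m : ℕ) :
    specialize (m : K) (fracPow T g) = (T ^ m) g := by
  ext n
  have h_dvd : PowerSeries.X ^ 0 ∣ g := one_dvd g
  rw [coeff_specialize, coeff_fracPow_of_X_pow_dvd hT h_dvd (show n - 0 ≤ n + m by lia),
    Polynomial.eval_finsetSum, pow_eq_sum_choose_smul_sub_one_pow T m, LinearMap.sum_apply, map_sum]
  simp only [Polynomial.eval_mul, eval_choosePoly, Polynomial.eval_C, Ring.choose_natCast,
    LinearMap.smul_apply, map_nsmul]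
  refine (Finset.sum_subset_zero_on_sdiff ?_ ?_ fun p _ => nsmul_eq_mul _ _).symm
  · intro p hp
    rw [Finset.mem_range] at hp
    exact Finset.mem_Icc.mpr ⟨p.zero_le, by lia⟩
  · intro p hp
    have hmp : m < p := by simpa using (Finset.mem_sdiff.mp hp).2
    rw [Nat.choose_eq_zero_of_lt hmp, Nat.cast_zero, zero_mul]

theorem eval_coeff_fracPow (hg : PowerSeries.X ^ k ∣ g) (n : ℕ) (s : K) :
    (coeff n (fracPow T g)).eval s =
      ∑ p ∈ Finset.Icc 0 (n - k), Ring.choose s p * coeff n (((T - 1) ^ p) g) := by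
  rw [coeff_fracPow_of_X_pow_dvd hT hg le_rfl, Polynomial.eval_finsetSum]
  simp only [Polynomial.eval_mul, eval_choosePoly, Polynomial.eval_C]

theorem eval_natCast_coeff_fracPow (g : K⟦X⟧) (n m : ℕ) :
    (coeff n (fracPow T g)).eval (m : K) = coeff n ((T ^ m) g) := by
  rw [← coeff_specialize, specialize_natCast_fracPow hT]

theorem eval_coeff_fracPow_eq_sum_pow (hg : PowerSeries.X ^ k ∣ g) (n : ℕ) (s : K) :
    (coeff n (fracPow T g)).eval s =
      ∑ p ∈ Finset.Icc 0 (n - k),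
        Ring.choose s p * Ring.choose (((n - k : ℕ) : K) - s) (n - k - p) *
          coeff n ((T ^ p) g) := by
  simp only [eval_eq_sum_choose_mul_choose (natDegree_coeff_fracPow_le hT hg n) s,
    eval_natCast_coeff_fracPow hT]

theorem eval_zero_derivative_coeff_fracPow (hg : PowerSeries.X ^ k ∣ g) (n : ℕ) :
    (Polynomial.derivative (coeff n (fracPow T g))).eval 0 =
      ∑ p ∈ Finset.Icc 1 (n - k), (-1) ^ (p - 1) / p * coeff n (((T - 1) ^ p) g) := by
  rw [coeff_fracPow_of_X_pow_dvd hT hg le_rfl, eval_zero_derivative_sum_choosePoly_mul]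
  simp

theorem eval_zero_derivative_coeff_fracPow_eq_sum_pow (hg : PowerSeries.X ^ k ∣ g) {n : ℕ}
    (hn : coeff n g = 0) :
    (Polynomial.derivative (coeff n (fracPow T g))).eval 0 =
      ∑ p ∈ Finset.Icc 1 (n - k), (-1) ^ (p - 1) / p * (n - k).choose p * coeff n ((T ^ p) g) := by
  have h₀ : (coeff n (fracPow T g)).eval 0 = 0 := by
    simpa [hn] using eval_natCast_coeff_fracPow hT g n 0
  simp only [eval_zero_derivative_eq_sum_choose (natDegree_coeff_fracPow_le hT hg n) h₀,
    eval_natCast_coeff_fracPow hT]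

end FractionalPowers

section FractionalIterates

variable {K : Type*} [Field K] {f : K⟦X⟧}

theorem IsFractionalIteration.zero (hf : IsUnitary f) {F : K → K⟦X⟧}
    (hF : IsFractionalIteration f F) : F 0 = PowerSeries.X := by
  have hsub_f : PowerSeries.HasSubst f := .of_constantCoeff_zero' hf.constantCoeff_eq
  have hsub_F : PowerSeries.HasSubst (F 0) := .of_constantCoeff_zero' (hF.constantCoeff_eq 0)
  have h_left : hf.compInv.subst f = PowerSeries.X :=
    PowerSeries.subst_substInvOfIsUnit_left _ hf.constantCoeff_eq _
  have h_fixed : f.subst (F 0) = f := by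
    simpa only [hF.one, add_zero] using hF.comp 1 0
  have h_assoc := PowerSeries.subst_comp_subst_apply hsub_f hsub_F hf.compInv
  rwa [h_fixed, h_left, PowerSeries.subst_X hsub_F] at h_assoc

theorem IsFractionalIteration.natCast (hf : IsUnitary f) {F : K → K⟦X⟧}
    (hF : IsFractionalIteration f F) (m : ℕ) :
    F m = (compOp hf.constantCoeff_eq ^ m) PowerSeries.X := by
  induction m with
  | zero => rw [Nat.cast_zero, hF.zero hf, pow_zero, Module.End.one_apply]
  | succ m ih =>
    rw [Nat.cast_succ, ← hF.comp, hF.one, ih, pow_succ', Module.End.mul_apply, compOp_apply]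

/-- The fractional iterate `f ^ s = T ^ s X`, where `T` is composition with `f`. -/
def fractionalIterate (hf : IsUnitary f) (s : K) : K⟦X⟧ :=
  specialize s (fracPow (compOp hf.constantCoeff_eq) PowerSeries.X)

variable [CharZero K]

theorem fracPow_compOp_X_pow (hf : IsUnitary f) (k : ℕ) :
    fracPow (compOp hf.constantCoeff_eq) (PowerSeries.X ^ k) =
      fracPow (compOp hf.constantCoeff_eq) PowerSeries.X ^ k :=
  eq_of_specialize_natCast_eq fun m => by
    simp only [map_pow, specialize_natCast_fracPow hf.raisesOrder_compOp_sub_one,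
      compOp_pow_X_pow]

theorem coeff_smul_fractionalIterate_pow (hf : IsUnitary f) (c s : K) (n k : ℕ) :
    coeff n (c • fractionalIterate hf s ^ k) =
      c * (coeff n (fracPow (compOp hf.constantCoeff_eq) (PowerSeries.X ^ k))).eval s := by
  rw [fracPow_compOp_X_pow hf, map_smul, smul_eq_mul, fractionalIterate, ← map_pow,
    coeff_specialize]

theorem constantCoeff_fracPow_compOp_X (hf : IsUnitary f) :
    constantCoeff (fracPow (compOp hf.constantCoeff_eq) PowerSeries.X) = 0 :=
  polynomial_eq_of_eval_natCast_eq fun m => by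
    rw [← PowerSeries.coeff_zero_eq_constantCoeff_apply,
      eval_natCast_coeff_fracPow hf.raisesOrder_compOp_sub_one,
      PowerSeries.coeff_zero_eq_constantCoeff_apply, constantCoeff_compOp_pow_X,
      Polynomial.eval_zero]

theorem isFractionalIteration_fractionalIterate (hf : IsUnitary f) :
    IsFractionalIteration f (fractionalIterate hf) where
  constantCoeff_eq s := by
    have h := constantCoeff_fracPow_compOp_X hf
    rw [← PowerSeries.coeff_zero_eq_constantCoeff_apply] at h ⊢
    rw [fractionalIterate, coeff_specialize, h, Polynomial.eval_zero]
  one := by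
    rw [fractionalIterate, ← Nat.cast_one,
      specialize_natCast_fracPow hf.raisesOrder_compOp_sub_one, pow_one, compOp_apply,
      PowerSeries.subst_X (.of_constantCoeff_zero' hf.constantCoeff_eq)]
  comp := specialize_subst_specialize (constantCoeff_fracPow_compOp_X hf) fun a b => by
    rw [← Nat.cast_add]
    simp only [specialize_natCast_fracPow hf.raisesOrder_compOp_sub_one]
    rw [← compOp_pow_apply, ← Module.End.mul_apply, ← pow_add, add_comm]
  polynomial n := ⟨_, fun s => coeff_specialize s _ n⟩

theorem X_pow_dvd_fractionalIterate_pow (hf : IsUnitary f) (s : K) (k : ℕ) :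
    PowerSeries.X ^ k ∣ fractionalIterate hf s ^ k :=
  pow_dvd_pow_of_dvd (PowerSeries.X_dvd_iff.mpr
    ((isFractionalIteration_fractionalIterate hf).constantCoeff_eq s)) k

theorem IsFractionalIteration.eq_fractionalIterate (hf : IsUnitary f) {F : K → K⟦X⟧}
    (hF : IsFractionalIteration f F) : F = fractionalIterate hf := by
  obtain ⟨Φ, hΦ⟩ := exists_specialize_eq hF.polynomial
  have h : Φ = fracPow (compOp hf.constantCoeff_eq) PowerSeries.X :=
    eq_of_specialize_natCast_eq fun m => by
      rw [← hΦ, hF.natCast hf, specialize_natCast_fracPow hf.raisesOrder_compOp_sub_one]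
  funext s
  rw [hΦ, h, fractionalIterate]

theorem isIterativeLog_specialize_iff (Φ : K[X]⟦X⟧) (g : K⟦X⟧) :
    IsIterativeLog (fun s => specialize s Φ) g ↔
      ∀ n, coeff n g = (Polynomial.derivative (coeff n Φ)).eval 0 := by
  refine forall_congr' fun n => ⟨?_, fun hn => ⟨coeff n Φ, fun s => rfl, hn⟩⟩
  rintro ⟨P, hP, hg⟩
  have hPΦ : coeff n Φ = P := polynomial_eq_of_eval_natCast_eq fun m => hP m
  rw [hg, hPΦ]

theorem existsUnique_isIterativeLog_specialize (Φ : K[X]⟦X⟧) :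
    ∃! g, IsIterativeLog (fun s => specialize s Φ) g := by
  simp only [isIterativeLog_specialize_iff]
  refine ⟨PowerSeries.mk fun n => (Polynomial.derivative (coeff n Φ)).eval 0,
    fun n => PowerSeries.coeff_mk _ _, fun g hg => ?_⟩
  ext n
  rw [hg, PowerSeries.coeff_mk]

theorem IsIterativeLog.coeff_eq (hf : IsUnitary f) {g : K⟦X⟧}
    (hg : IsIterativeLog (fractionalIterate hf) g) (n : ℕ) :
    coeff n g = (Polynomial.derivative
      (coeff n (fracPow (compOp hf.constantCoeff_eq) PowerSeries.X))).eval 0 :=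
  (isIterativeLog_specialize_iff _ g).mp hg n

theorem IsIterativeLog.X_sq_dvd (hf : IsUnitary f) {g : K⟦X⟧}
    (hg : IsIterativeLog (fractionalIterate hf) g) : PowerSeries.X ^ 2 ∣ g := by
  refine PowerSeries.X_pow_dvd_iff.mpr fun n hn => ?_
  have h_deg := natDegree_coeff_fracPow_le hf.raisesOrder_compOp_sub_one
    (pow_one PowerSeries.X).dvd n
  rw [hg.coeff_eq hf, Polynomial.derivative_of_natDegree_zero (by lia), Polynomial.eval_zero]

end FractionalIterates

section Duality

variable {K : Type*} [Field K]

/-- The pairing `⟨g, p⟩ = (g(D) p)(0) = ∑ₙ n! gₙ pₙ` of a power series with a polynomial. -/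
def pairing : K⟦X⟧ →ₗ[K] K[X] →ₗ[K] K :=
  ((Polynomial.basisMonomials K).constr K).toLinearMap ∘ₗ
    LinearMap.pi fun n => n ! • PowerSeries.coeff n

theorem pairing_X_pow (g : K⟦X⟧) (n : ℕ) : pairing g (Polynomial.X ^ n) = n ! * coeff n g := by
  have h : pairing g (Polynomial.basisMonomials K n) = n ! • coeff n g :=
    (Polynomial.basisMonomials K).constr_basis K (fun n => n ! • coeff n g) n
  simpa only [Polynomial.coe_basisMonomials, Polynomial.monomial_one_right_eq_X_pow,
    nsmul_eq_mul] using h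

theorem pairing_X_pow_left (k : ℕ) (p : K[X]) :
    pairing (PowerSeries.X ^ k) p = k ! * p.coeff k := by
  induction p using Polynomial.induction_on' with
  | add p q hp hq => rw [map_add, hp, hq, Polynomial.coeff_add, mul_add]
  | monomial n c =>
    rw [← Polynomial.C_mul_X_pow_eq_monomial, ← Polynomial.smul_eq_C_mul, map_smul, pairing_X_pow,
      PowerSeries.coeff_X_pow, Polynomial.coeff_smul, Polynomial.coeff_X_pow]
    rcases eq_or_ne n k with rfl | h
    · simp [mul_comm]
    · simp [h, h.symm]

theorem pairing_opD (g h : K⟦X⟧) (p : K[X]) : pairing g (opD h p) = pairing (h * g) p := by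
  induction p using Polynomial.induction_on' with
  | add p q hp hq => rw [map_add, map_add, map_add, hp, hq]
  | monomial n c =>
    rw [← Polynomial.C_mul_X_pow_eq_monomial, ← Polynomial.smul_eq_C_mul, map_smul, map_smul,
      map_smul, pairing_X_pow, PowerSeries.coeff_mul,
      Finset.Nat.sum_antidiagonal_eq_sum_range_succ_mk]
    congr 1
    simp only [opD, LinearMap.coe_mk, AddHom.coe_mk, Polynomial.natDegree_X_pow, map_sum, map_smul,
      Polynomial.iterate_derivative_X_pow_eq_smul, pairing_X_pow, Finset.mul_sum]
    refine Finset.sum_congr rfl fun j hj => ?_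
    have hfac : ((n - j)! : K) * n.descFactorial j = n ! := by
      exact_mod_cast congrArg (Nat.cast (R := K)) <|
        Nat.factorial_mul_descFactorial (Nat.lt_succ_iff.mp (Finset.mem_range.mp hj))
    rw [← hfac]
    simp only [smul_eq_mul]
    ring

/-- `T` and `U` are transpose to each other under the pairing of series with polynomials. -/
def IsTranspose (T : Module.End K K⟦X⟧) (U : Module.End K K[X]) : Prop :=
  ∀ g p, pairing (T g) p = pairing g (U p)

namespace IsTranspose

variable {T : Module.End K K⟦X⟧} {U : Module.End K K[X]}

theorem sub_one (h : IsTranspose T U) : IsTranspose (T - 1) (U - 1) := fun g p => by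
  simp only [LinearMap.sub_apply, Module.End.one_apply, map_sub, h g p]

theorem pow (h : IsTranspose T U) (m : ℕ) : IsTranspose (T ^ m) (U ^ m) := by
  induction m with
  | zero => exact fun g p => rfl
  | succ m ih =>
    intro g p
    rw [pow_succ, Module.End.mul_apply, ih, h, pow_succ', Module.End.mul_apply]

theorem inv_factorial_mul_coeff [CharZero K] (h : IsTranspose T U) (n k : ℕ) :
    (k ! : K)⁻¹ * coeff n (T (PowerSeries.X ^ k)) = (n ! : K)⁻¹ * opCoeff U n k := by
  have key : (n ! : K) * coeff n (T (PowerSeries.X ^ k)) = k ! * opCoeff U n k := by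
    rw [← pairing_X_pow, h, pairing_X_pow_left, opCoeff]
  have hn : (n ! : K) ≠ 0 := Nat.cast_ne_zero.mpr n.factorial_ne_zero
  have hk : (k ! : K) ≠ 0 := Nat.cast_ne_zero.mpr k.factorial_ne_zero
  rw [inv_mul_eq_iff_eq_mul₀ hk, mul_left_comm, ← key, inv_mul_cancel_left₀ hn]

theorem inv_factorial_mul_sum [CharZero K] {T : ℕ → Module.End K K⟦X⟧}
    {U : ℕ → Module.End K K[X]} (h : ∀ p, IsTranspose (T p) (U p)) (S : Finset ℕ) (c : ℕ → K)
    (n k : ℕ) :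
    (k ! : K)⁻¹ * ∑ p ∈ S, c p * coeff n (T p (PowerSeries.X ^ k)) =
      (n ! : K)⁻¹ * ∑ p ∈ S, c p * opCoeff (U p) n k := by
  simp only [Finset.mul_sum, mul_left_comm _ (c _), (h _).inv_factorial_mul_coeff]

end IsTranspose

theorem IsUmbral.pairing_C {U Q : Module.End K K[X]} (hU : IsUmbral U Q) (c : K) (n : ℕ) :
    pairing (PowerSeries.C c) (U (Polynomial.X ^ n)) =
      pairing (PowerSeries.C c) (Polynomial.X ^ n) := by
  rw [← mul_one (PowerSeries.C c), ← PowerSeries.smul_eq_C_mul, map_smul, LinearMap.smul_apply,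
    LinearMap.smul_apply, ← pow_zero PowerSeries.X, pairing_X_pow_left, pairing_X_pow_left,
    Polynomial.coeff_zero_eq_eval_zero, Polynomial.coeff_zero_eq_eval_zero]
  rcases n.eq_zero_or_pos with rfl | hn
  · rw [hU.map_one, pow_zero]
  · rw [hU.eval_zero n hn, Polynomial.eval_pow, Polynomial.eval_X, zero_pow hn.ne']

theorem IsUmbral.pairing_subst {U : Module.End K K[X]} {q : K⟦X⟧} (hU : IsUmbral U (opD q))
    (hq : constantCoeff q = 0) (h : K⟦X⟧) (n : ℕ) :
    pairing (h.subst q) (U (Polynomial.X ^ n)) = pairing h (Polynomial.X ^ n) := by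
  induction n generalizing h with
  | zero =>
    rw [subst_eq_mul_subst_add_C hq, map_add, LinearMap.add_apply, ← pairing_opD, hU.pairing_C,
      hU.sheffer_zero, map_zero, zero_add, pairing_X_pow, pairing_X_pow,
      PowerSeries.coeff_zero_C, PowerSeries.coeff_zero_eq_constantCoeff_apply]
  | succ n ih =>
    rw [subst_eq_mul_subst_add_C hq, map_add, LinearMap.add_apply, ← pairing_opD, hU.pairing_C,
      hU.sheffer_succ, map_smul, ih, pairing_X_pow, pairing_X_pow, pairing_X_pow,
      PowerSeries.coeff_mk, PowerSeries.coeff_succ_C, mul_zero, add_zero, Nat.factorial_succ,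
      Nat.cast_mul, smul_eq_mul, mul_assoc]

theorem IsUmbral.isTranspose {f : K⟦X⟧} (hf : IsUnitary f) {U : Module.End K K[X]}
    (hU : IsUmbral U (opD hf.compInv)) : IsTranspose (compOp hf.constantCoeff_eq) U := by
  intro g p
  have hsub_f : PowerSeries.HasSubst f := .of_constantCoeff_zero' hf.constantCoeff_eq
  have hsub_inv : PowerSeries.HasSubst hf.compInv := .substInvOfIsUnit _ _
  have h_right : f.subst hf.compInv = PowerSeries.X :=
    PowerSeries.subst_substInvOfIsUnit_right _ hf.constantCoeff_eq _
  have h_inv : PowerSeries.subst hf.compInv (g.subst f) = g := by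
    rw [PowerSeries.subst_comp_subst_apply hsub_f hsub_inv, h_right, PowerSeries.X_subst]
  induction p using Polynomial.induction_on' with
  | add p q hp hq => simp only [map_add, hp, hq]
  | monomial n c =>
    rw [← Polynomial.C_mul_X_pow_eq_monomial, ← Polynomial.smul_eq_C_mul, map_smul, map_smul,
      map_smul, compOp_apply, ← hU.pairing_subst (PowerSeries.constantCoeff_substInvOfIsUnit _ _),
      h_inv]

end Duality

section UmbralFormulas

variable {K : Type*} [Field K] [CharZero K] {T : Module.End K K⟦X⟧} {U : Module.End K K[X]}

theorem inv_factorial_mul_eval_coeff_fracPow (hT : RaisesOrder (T - 1)) (hTU : IsTranspose T U)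
    (n k : ℕ) (s : K) :
    (k ! : K)⁻¹ * (coeff n (fracPow T (PowerSeries.X ^ k))).eval s =
      (n ! : K)⁻¹ * ∑ p ∈ Finset.Icc 0 (n - k),
        Ring.choose s p * opCoeff ((U - 1) ^ p) n k := by
  rw [eval_coeff_fracPow hT dvd_rfl, IsTranspose.inv_factorial_mul_sum fun p => hTU.sub_one.pow p]

theorem inv_factorial_mul_eval_coeff_fracPow_eq_sum_pow (hT : RaisesOrder (T - 1))
    (hTU : IsTranspose T U) {n k : ℕ} (hkn : k ≤ n) (s : K) :
    (k ! : K)⁻¹ * (coeff n (fracPow T (PowerSeries.X ^ k))).eval s =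
      (n ! : K)⁻¹ * ∑ p ∈ Finset.Icc 0 (n - k),
        Ring.choose s p * Ring.choose ((n : K) - k - s) (n - k - p) * opCoeff (U ^ p) n k := by
  rw [eval_coeff_fracPow_eq_sum_pow hT dvd_rfl, IsTranspose.inv_factorial_mul_sum hTU.pow,
    Nat.cast_sub hkn]

theorem inv_factorial_mul_eval_zero_derivative_coeff_fracPow (hT : RaisesOrder (T - 1))
    (hTU : IsTranspose T U) (n k : ℕ) :
    (k ! : K)⁻¹ * (Polynomial.derivative (coeff n (fracPow T (PowerSeries.X ^ k)))).eval 0 =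
      (n ! : K)⁻¹ * ∑ p ∈ Finset.Icc 1 (n - k),
        (-1) ^ (p - 1) / (p : K) * opCoeff ((U - 1) ^ p) n k := by
  rw [eval_zero_derivative_coeff_fracPow hT dvd_rfl,
    IsTranspose.inv_factorial_mul_sum fun p => hTU.sub_one.pow p]

theorem inv_factorial_mul_eval_zero_derivative_coeff_fracPow_eq_sum_pow
    (hT : RaisesOrder (T - 1)) (hTU : IsTranspose T U) {n k : ℕ} (hkn : n ≠ k) :
    (k ! : K)⁻¹ * (Polynomial.derivative (coeff n (fracPow T (PowerSeries.X ^ k)))).eval 0 =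
      (n ! : K)⁻¹ * ∑ p ∈ Finset.Icc 1 (n - k),
        (-1) ^ (p - 1) / (p : K) * ((n - k).choose p : K) * opCoeff (U ^ p) n k := by
  have hcoeff : coeff n (PowerSeries.X ^ k : K⟦X⟧) = 0 := by
    rw [PowerSeries.coeff_X_pow, if_neg hkn]
  rw [eval_zero_derivative_coeff_fracPow_eq_sum_pow hT dvd_rfl hcoeff,
    IsTranspose.inv_factorial_mul_sum hTU.pow]

end UmbralFormulas

end Umbral

end

theorem mainTheorem1 {K : Type*} [Field K] [CharZero K]
    (f : PowerSeries K) (hf : Umbral.IsUnitary f)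
    (φ : Module.End K (Polynomial K)) (hφ : Umbral.IsUmbral φ (Umbral.opD hf.compInv)) :
    (∃! F : K → PowerSeries K, Umbral.IsFractionalIteration f F) ∧
    ∀ F : K → PowerSeries K, Umbral.IsFractionalIteration f F →
      (∀ (s : K) (k : ℕ),
        ((k.factorial : K)⁻¹ • (F s) ^ k =
          PowerSeries.mk fun n => if k ≤ n then
            (n.factorial : K)⁻¹ * ∑ p ∈ Finset.Icc 0 (n - k),
              Ring.choose s p * Umbral.opCoeff ((φ - 1) ^ p) n k
          else 0) ∧
        ((k.factorial : K)⁻¹ • (F s) ^ k =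
          PowerSeries.mk fun n => if k ≤ n then
            (n.factorial : K)⁻¹ * ∑ p ∈ Finset.Icc 0 (n - k),
              Ring.choose s p * Ring.choose ((n : K) - k - s) (n - k - p) *
                Umbral.opCoeff (φ ^ p) n k
          else 0)) ∧
      (∃! g : PowerSeries K, Umbral.IsIterativeLog F g) ∧
      ∀ g : PowerSeries K, Umbral.IsIterativeLog F g →
        (g = PowerSeries.mk fun n => if 2 ≤ n then
            (n.factorial : K)⁻¹ * ∑ p ∈ Finset.Icc 1 (n - 1),
              (-1) ^ (p - 1) / (p : K) * Umbral.opCoeff ((φ - 1) ^ p) n 1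
          else 0) ∧
        (g = PowerSeries.mk fun n => if 2 ≤ n then
            (n.factorial : K)⁻¹ * ∑ p ∈ Finset.Icc 1 (n - 1),
              (-1) ^ (p - 1) / (p : K) * ((n - 1).choose p : K) *
                Umbral.opCoeff (φ ^ p) n 1
          else 0) := by
  have hT := hf.raisesOrder_compOp_sub_one
  have hTφ := hφ.isTranspose hf
  refine ⟨⟨Umbral.fractionalIterate hf, Umbral.isFractionalIteration_fractionalIterate hf,
    fun F hF => hF.eq_fractionalIterate hf⟩, fun F hF => ?_⟩
  obtain rfl := hF.eq_fractionalIterate hf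
  refine ⟨fun s k => ?_, Umbral.existsUnique_isIterativeLog_specialize _, fun g hg => ?_⟩
  · have h_dvd := dvd_smul_of_dvd (k.factorial : K)⁻¹
      (Umbral.X_pow_dvd_fractionalIterate_pow hf s k)
    simp only [Umbral.eq_mk_ite_iff h_dvd, Umbral.coeff_smul_fractionalIterate_pow]
    exact ⟨fun n _ => Umbral.inv_factorial_mul_eval_coeff_fracPow hT hTφ n k s,
      fun n hn => Umbral.inv_factorial_mul_eval_coeff_fracPow_eq_sum_pow hT hTφ hn s⟩
  · simp only [Umbral.eq_mk_ite_iff (hg.X_sq_dvd hf), hg.coeff_eq hf]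
    refine ⟨fun n _ => ?_, fun n hn => ?_⟩
    · simpa using Umbral.inv_factorial_mul_eval_zero_derivative_coeff_fracPow hT hTφ n 1
    · have h_ne : n ≠ 1 := by lia
      simpa using
        Umbral.inv_factorial_mul_eval_zero_derivative_coeff_fracPow_eq_sum_pow hT hTφ h_ne
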